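/- Corollary. Let $N=\mathbb{Z}^2$ with dual lattice $M=\operatorname{Hom}(N,\mathbb{Z})\cong\mathbb{Z}^2$ (identified via the dual basis), and let $l\ge 1$ be an integer. An $l$-reflexive loop $P$ is given by a cyclic sequence $x_1,\dots,x_t\in N$ ($t\ge 1$, indices modulo $t$) of non-zero lattice points, its boundary lattice points, such that for every $i$: (1) $x_{i+1}-x_i$ is primitive; (2) $\det(x_i,x_{i+1})=\pm l$; (3) if $x_i$ is a vertex, i.e. $x_i\notin\operatorname{conv}\{x_{i-1},x_{i+1}\}$, then $x_i$ is primitive. The loop may be non-convex or self-intersecting. Let $u_i\in M$ be the primitive outer normal of the segment $[x_i,x_{i+1}]$, i.e. the unique primitive element of $M$ that is constant and positive on this segment. The boundary lattice points of the dual loop $lP^*$ are, in order, the lattice points of the successive segments $[u_i,u_{i+1}]$ (the common endpoint of consecutive segments being counted once, and segments with $u_i=u_{i+1}$ contributing no further point). The length of a loop with boundary lattice points $y_1,\dots,y_s$ (indices modulo $s$) is the signed quantity $\sum_{j=1}^{s}\det(y_j,y_{j+1})/l$ (so it is $0$ if all the $u_i$ coincide and $lP^*$ degenerates to a point). Let $w(P)$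 be the winding number around the origin of the closed polygon $x_1,x_2,\dots,x_t,x_1$, that is, $\frac1{2\pi}$ times the sum of the signed angles in $(-\pi,\pi)$ from $x_i$ to $x_{i+1}$. Then, for every $l$-reflexive loop $P$, the number $w(P)$ is an integer, and the length of $P$ plus the length of $lP^*$ equals $12\,w(P)$. -/

import Mathlib

namespace ReflexiveLoop

/-- The lattice `ℤ²`. It serves as `N`, and, through the dual basis, as `M = Hom(N, ℤ)`. -/
abbrev Lat : Type := ℤ × ℤ

/-- The pairing `⟨u, x⟩` of `u ∈ M` with `x ∈ N`. -/
def pairing (u x : Lat) : ℤ := u.1 * x.1 + u.2 * x.2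

/-- The determinant of the `2 × 2` matrix with rows `x` and `y`. -/
def det (x y : Lat) : ℤ := x.1 * y.2 - x.2 * y.1

/-- A lattice point is primitive if it is non-zero and the segment from the origin to it contains
no further lattice point, that is, if its coordinates have greatest common divisor `1`. -/
def Primitive (v : Lat) : Prop := Int.gcd v.1 v.2 = 1

/-- The inclusion of the lattice in `N_ℚ = ℚ²`. -/
def toRat (x : Lat) : ℚ × ℚ := ((x.1 : ℚ), (x.2 : ℚ))

/-- The point with number `i` (counted from `0`) of the finite sequence `xs`, with the indices
read cyclically. (For the empty sequence the value is irrelevant.) -/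
def cyc (xs : List Lat) (i : ℕ) : Lat := xs.getD (i % xs.length) 0

/-- The cyclic sequence `xs` of lattice points is the sequence of boundary lattice points of an
`l`-reflexive loop. Indices are cyclic, so the last condition speaks about every point of `xs`. -/
structure IsReflexiveLoop (l : ℕ) (xs : List Lat) : Prop where
  index_pos : 0 < l
  nonempty : xs ≠ []
  ne_zero : ∀ i, cyc xs i ≠ 0
  primitive_step : ∀ i, Primitive (cyc xs (i + 1) - cyc xs i)
  det_eq : ∀ i, det (cyc xs i) (cyc xs (i + 1)) = l ∨ det (cyc xs i) (cyc xs (i + 1)) = -l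
  primitive_vertex : ∀ i,
    toRat (cyc xs (i + 1)) ∉ segment ℚ (toRat (cyc xs i)) (toRat (cyc xs (i + 2))) →
      Primitive (cyc xs (i + 1))

/-- The (signed) length `∑ det(xᵢ, xᵢ₊₁) / l` of a loop with boundary lattice points `xs`. -/
def length (l : ℕ) (xs : List Lat) : ℚ :=
  ∑ i ∈ Finset.range xs.length, (det (cyc xs i) (cyc xs (i + 1)) : ℚ) / (l : ℚ)

/-- `u` is the primitive outer normal of the segment `[x, y]`: it is primitive, and takes one and
the same positive value at `x` and at `y`. -/
def IsOuterNormal (u x y : Lat) : Prop :=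
  Primitive u ∧ pairing u x = pairing u y ∧ 0 < pairing u x

/-- The primitive outer normal of the segment `[x, y]`, where `y - x` is primitive and
`det x y ≠ 0`; see `isOuterNormal_iff`. -/
def outerNormal (x y : Lat) : Lat :=
  ((det x y).sign * (y.2 - x.2), (det x y).sign * (x.1 - y.1))

theorem isOuterNormal_iff {x y : Lat} (hp : Primitive (y - x)) (hd : det x y ≠ 0) (u : Lat) :
    IsOuterNormal u x y ↔ u = outerNormal x y := by
  obtain ⟨a, b⟩ := x
  obtain ⟨c, d⟩ := y
  obtain ⟨p, q⟩ := u
  simp only [IsOuterNormal, Primitive, pairing, outerNormal, det, Prod.fst_sub, Prod.snd_sub,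
    Prod.mk.injEq, ← Int.isCoprime_iff_gcd_eq_one] at *
  have key : ∀ s D : ℤ, D = a * d - b * c → (D = s * |D|) → s * s = 1 → D ≠ 0 →
      ((IsCoprime p q ∧ p * a + q * b = p * c + q * d ∧ 0 < p * a + q * b) ↔
        p = s * (d - b) ∧ q = s * (a - c)) := by
    intro s D hD hs hss hD0
    have hDpos : 0 < |D| := abs_pos.2 hD0
    constructor
    · rintro ⟨⟨e, f, hef⟩, h2, h3⟩
      obtain ⟨g, h, hgh⟩ := hp
      have h2' : p * (c - a) = -(q * (d - b)) := by linarith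
      obtain ⟨k, hk1, hk2⟩ : ∃ k : ℤ, p = k * (d - b) ∧ q = k * (a - c) := by
        refine ⟨p * h - q * g, ?_, ?_⟩
        · linear_combination (-p) * hgh + g * h2'
        · linear_combination (-q) * hgh + h * h2'
      have hku : k * (e * (d - b) + f * (a - c)) = 1 := by
        rw [hk1, hk2] at hef; linarith
      have hkD : 0 < (k * s) * |D| := by
        have : p * a + q * b = k * D := by rw [hk1, hk2, hD]; ring
        rw [this, hs] at h3; linarith
      have hks : 0 < k * s := (mul_pos_iff_of_pos_right hDpos).1 hkD
      have hk1' : k = 1 ∨ k = -1 := Int.isUnit_iff.1 (IsUnit.of_mul_eq_one _ hku)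
      have hs1 : s = 1 ∨ s = -1 := Int.isUnit_iff.1 (IsUnit.of_mul_eq_one _ hss)
      have : k = s := by
        rcases hk1' with h1 | h1 <;> rcases hs1 with h2 | h2 <;> rw [h1, h2] at hks ⊢ <;>
          norm_num at hks
      rw [← this]; exact ⟨hk1, hk2⟩
    · rintro ⟨rfl, rfl⟩
      obtain ⟨g, h, hgh⟩ := hp
      refine ⟨⟨s * h, -(s * g), ?_⟩, by ring, ?_⟩
      · linear_combination hss * (g * (c - a) + h * (d - b)) + hgh
      · have : s * (d - b) * a + s * (a - c) * b = |D| := by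
          calc _ = s * D := by rw [hD]; ring
            _ = (s * s) * |D| := by rw [mul_assoc, ← hs]
            _ = |D| := by rw [hss, one_mul]
        rw [this]; exact hDpos
  refine key _ _ rfl (Int.sign_mul_abs _).symm ?_ hd
  rcases lt_or_gt_of_ne hd with h | h
  · rw [Int.sign_eq_neg_one_of_neg h]; norm_num
  · rw [Int.sign_eq_one_of_pos h]; norm_num

/-- The lattice points of the segment `[a, b]` in their order from `a` (included) to `b`
(excluded). -/
def segmentPoints (a b : Lat) : List Lat :=
  (List.range (Int.gcd (b.1 - a.1) (b.2 - a.2))).map fun j =>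
    (a.1 + j * ((b.1 - a.1) / Int.gcd (b.1 - a.1) (b.2 - a.2)),
      a.2 + j * ((b.2 - a.2) / Int.gcd (b.1 - a.1) (b.2 - a.2)))

/-- The cyclic sequence of boundary lattice points of the dual loop `l P*`: the lattice points of
the segments `[uᵢ, uᵢ₊₁]`, run through in order, where `uᵢ` is the primitive outer normal of
`[xᵢ, xᵢ₊₁]`. -/
def dual (xs : List Lat) : List Lat :=
  (List.range xs.length).flatMap fun i =>
    segmentPoints (outerNormal (cyc xs i) (cyc xs (i + 1)))
      (outerNormal (cyc xs (i + 1)) (cyc xs (i + 2)))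

/-- The lattice point `x` as a complex number. -/
def toComplex (x : Lat) : ℂ := ⟨(x.1 : ℝ), (x.2 : ℝ)⟩

/-- The winding number around the origin of the closed polygon through the points `xs`: the total
change of the argument along the polygon, divided by `2π`. Along an edge `[x, y]` that does not
contain the origin the argument changes by the signed angle from `x` to `y`, which is
`arg (y / x) ∈ (-π, π)`. -/
noncomputable def windingNumber (xs : List Lat) : ℝ :=
  (∑ i ∈ Finset.range xs.length,
    Complex.arg (toComplex (cyc xs (i + 1)) / toComplex (cyc xs i))) / (2 * Real.pi)

end ReflexiveLoop

/-! Write `eᵢ = ±1` for the sign of `det xᵢ xᵢ₊₁`. The loop satisfies `eᵢ₊₁ xᵢ + eᵢ xᵢ₊₂ = cᵢ xᵢ₊₁`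
with integers `cᵢ` (`exists_recursion`). With lattice points read as complex numbers, `τᵢ = eᵢ xᵢ₊₁
/ xᵢ` lies in the upper half plane and `τᵢ₊₁ = -1/τᵢ + eᵢ eᵢ₊₁ cᵢ`. The normalised argument `R` of
the Dedekind eta function turns this into numbers (`exists_arg_eta`, `arg_eta_step`): a translation
by `a` adds `a`, and the inversion adds `6/π · arg τ - 3`. Since `τ` is periodic, summing around the
loop gives `0 = ∑ eᵢ eᵢ₊₁ cᵢ + 12 w - 3 ∑ eᵢ`; the 12 comes from the exponent `1/24` in eta. On the
other side, `P` has length `∑ eᵢ`, and the determinants of consecutive normals give `lP*` the length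
`2 ∑ eᵢ - ∑ eᵢ eᵢ₊₁ cᵢ`. The two lengths add up to `12 w`. -/

/-! ### The argument of the Dedekind eta function -/

open Complex in
theorem exists_log_of_differentiableOn_ball {f : ℂ → ℂ} {r : ℝ} (hr : 0 < r)
    (hf : DifferentiableOn ℂ f (Metric.ball 0 r)) (h0 : ∀ z ∈ Metric.ball 0 r, f z ≠ 0) :
    ∃ g : ℂ → ℂ, DifferentiableOn ℂ g (Metric.ball 0 r) ∧
      ∀ z ∈ Metric.ball 0 r, exp (g z) = f z := by
  have hd : DifferentiableOn ℂ (fun z => deriv f z / f z) (Metric.ball 0 r) :=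
    (hf.deriv Metric.isOpen_ball).div hf h0
  -- A primitive of the logarithmic derivative, normalised at `0`; then `exp F / f` is constant with
  -- value `1`.
  obtain ⟨F, hF⟩ := hd.isExactOn_ball.with_val_at 0 (log (f 0))
  have hmem : (0 : ℂ) ∈ Metric.ball (0 : ℂ) r := Metric.mem_ball_self hr
  have hF' : ∀ z ∈ Metric.ball (0 : ℂ) r, HasDerivAt F (deriv f z / f z) z := hF.2
  refine ⟨F, fun z hz => (hF' z hz).differentiableAt.differentiableWithinAt, ?_⟩
  have hk : ∀ z ∈ Metric.ball (0 : ℂ) r, HasDerivAt (fun z => exp (F z) / f z) 0 z := by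
    intro z hz
    have hfz := (hf.differentiableAt (Metric.isOpen_ball.mem_nhds hz)).hasDerivAt
    have h := (hF' z hz).cexp.div hfz (h0 z hz)
    rwa [mul_assoc, div_mul_cancel₀ _ (h0 z hz), sub_self, zero_div] at h
  intro z hz
  have hc : exp (F z) / f z = exp (F 0) / f 0 :=
    Metric.isOpen_ball.is_const_of_deriv_eq_zero
      (convex_ball (0 : ℂ) r).isPreconnected
      (fun w hw => (hk w hw).differentiableAt.differentiableWithinAt)
      (fun w hw => (hk w hw).deriv) hz hmem
  rw [hF.1, exp_log (h0 0 hmem), div_self (h0 0 hmem), div_eq_one_iff_eq (h0 z hz)] at hc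
  exact hc

open Complex hiding eta in
open UpperHalfPlane hiding I im in
open ModularForm in
/-- A holomorphic logarithm of the Dedekind eta function, with its behaviour under translation. -/
theorem exists_log_eta :
    ∃ g : ℂ → ℂ, DifferentiableOn ℂ g upperHalfPlaneSet ∧
      (∀ z ∈ upperHalfPlaneSet, exp (g z) = eta z) ∧
      ∀ (z : ℂ) (a : ℤ), g (z + a) = g z + 2 * Real.pi * I / 24 * a := by
  obtain ⟨G, hGd, hG⟩ := exists_log_of_differentiableOn_ball one_pos
    differentiableOn_tprod_one_sub_pow (by
      intro q hq
      rw [mem_ball_zero_iff] at hq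
      simp_rw [sub_eq_add_neg]
      refine tprod_one_add_ne_zero_of_summable (f := fun n : ℕ => -q ^ (n + 1)) ?_ ?_
      · intro n h
        rw [← sub_eq_add_neg, sub_eq_zero] at h
        have h1 : ‖q‖ ^ (n + 1) < 1 := pow_lt_one₀ (norm_nonneg _) hq (by omega)
        rw [← norm_pow, ← h, norm_one] at h1
        exact lt_irrefl _ h1
      · simpa using (summable_nat_add_iff 1).mpr
          (summable_geometric_of_lt_one (norm_nonneg _) hq))
  have hq : Set.MapsTo (Function.Periodic.qParam 1) upperHalfPlaneSet (Metric.ball (0 : ℂ) 1) :=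
    fun z hz => by simpa using norm_qParam_lt_one 1 ⟨z, hz⟩
  -- With `q = exp (2πiz)`, eta is `q^(1/24)` times a product that is holomorphic and zero-free on
  -- the unit disc. Its logarithm `G(q)` is 1-periodic in `z`, so a translation changes only the
  -- linear term.
  refine ⟨fun z => 2 * Real.pi * I / 24 * z + G (Function.Periodic.qParam 1 z), ?_, ?_, ?_⟩
  · exact DifferentiableOn.add (by fun_prop) (hGd.comp (by fun_prop) hq)
  · intro z hz
    rw [exp_add, hG _ (hq hz), eta, Function.Periodic.qParam]
    congr 2
    push_cast
    ring
  · intro z a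
    have : Function.Periodic.qParam 1 (z + a) = Function.Periodic.qParam 1 z := by
      refine exp_eq_exp_iff_exists_int.2 ⟨a, ?_⟩
      push_cast
      ring
    simp only [this]
    ring

open Complex hiding eta in
open UpperHalfPlane hiding I im in
open ModularForm in
/-- The argument of the Dedekind eta function, normalised: a real function on the upper half plane
whose behaviour under translation and inversion is explicit. -/
theorem exists_arg_eta :
    ∃ R : ℂ → ℝ, (∀ (z : ℂ) (a : ℤ), R (z + a) = R z + a) ∧
      ∀ z : ℂ, 0 < z.im → R (-1 / z) = R z + 6 / Real.pi * arg z - 3 := by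
  obtain ⟨g, hgd, hg, hT⟩ := exists_log_eta
  have hne : ∀ z : ℂ, 0 < z.im → z ≠ 0 := by
    rintro z hz rfl
    simp at hz
  have hmaps : Set.MapsTo (fun z : ℂ => -1 / z) upperHalfPlaneSet upperHalfPlaneSet := by
    intro z hz
    have h1 : 0 < z.im := hz
    have : (-1 / z).im = z.im / normSq z := by
      simp [div_eq_mul_inv, inv_im]
    change 0 < (-1 / z).im
    rw [this]
    exact div_pos h1 (normSq_pos.2 (hne z h1))
  have hslit : ∀ z ∈ upperHalfPlaneSet, z ∈ slitPlane := fun z hz => Or.inr (ne_of_gt hz)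
  -- The defect of the inversion law for the logarithm. The law for eta gives `exp D = 1`, so `D` is
  -- constant, and it vanishes at the fixed point `I` of the inversion.
  let D : ℂ → ℂ := fun z => g (-1 / z) - g z - (log z - log I) / 2
  have hDd : DifferentiableOn ℂ D upperHalfPlaneSet := by
    refine ((hgd.comp ?_ hmaps).sub hgd).sub (DifferentiableOn.div_const (DifferentiableOn.sub
      (fun z hz => (differentiableAt_log (hslit z hz)).differentiableWithinAt) (by fun_prop)) 2)
    exact DifferentiableOn.div (by fun_prop) (by fun_prop) fun z hz => hne z hz
  have hDe : ∀ z ∈ upperHalfPlaneSet, exp (D z) = 1 := by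
    intro z hz
    have h1 : eta (-1 / z) = (sqrt I)⁻¹ * (sqrt z * eta z) := eta_comp_eq_csqrt_I_inv hz
    rw [sqrt_eq_exp (hne z hz), sqrt_eq_exp I_ne_zero, ← hg z hz, ← hg _ (hmaps hz), ← exp_neg,
      ← exp_add, ← exp_add] at h1
    have : D z = g (-1 / z) - (-(log I / 2) + (log z / 2 + g z)) := by
      simp only [D]; ring
    rw [this, exp_sub, h1, div_self (exp_ne_zero _)]
  have hI : I ∈ upperHalfPlaneSet := by simp [upperHalfPlaneSet]
  have hDz : ∀ z ∈ upperHalfPlaneSet, D z = 0 := by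
    intro z hz
    have hD0 : D I = 0 := by simp [D]
    rw [← hD0]
    refine isOpen_upperHalfPlaneSet.is_const_of_deriv_eq_zero
      (convex_halfSpace_im_gt 0).isPreconnected hDd (fun w hw => ?_) hz hI
    have h1 := (hDd.differentiableAt (isOpen_upperHalfPlaneSet.mem_nhds hw)).hasDerivAt.cexp
    have h2 : HasDerivAt (fun z => exp (D z)) 0 w :=
      (hasDerivAt_const w (1 : ℂ)).congr_of_eventuallyEq <| by
        filter_upwards [isOpen_upperHalfPlaneSet.mem_nhds hw] with v hv using hDe v hv
    simpa [exp_ne_zero] using h1.unique h2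
  have hpi := Real.pi_ne_zero
  -- A unit translation adds `π/12` to `Im g`; the factor `12/π` makes this `1`.
  refine ⟨fun z => 12 / Real.pi * (g z).im, fun z a => ?_, fun z hz => ?_⟩
  · change 12 / Real.pi * (g (z + a)).im = 12 / Real.pi * (g z).im + a
    have h : 2 * (Real.pi : ℂ) * I / 24 * a = ((Real.pi / 12 * a : ℝ) : ℂ) * I := by
      push_cast; ring
    rw [hT, h, add_im, im_ofReal_mul, Complex.I_im]
    field_simp
  · change 12 / Real.pi * (g (-1 / z)).im = 12 / Real.pi * (g z).im + 6 / Real.pi * arg z - 3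
    have h := congrArg im (sub_eq_zero.1 (hDz z hz))
    have h2 : ((log z - log I) / 2).im = arg z / 2 - Real.pi / 4 := by
      rw [log_I, show (log z - Real.pi / 2 * I) / 2 = ((1 / 2 : ℝ) : ℂ) * log z
        - ((Real.pi / 4 : ℝ) : ℂ) * I by push_cast; ring, sub_im, im_ofReal_mul, log_im]
      simp
      ring
    rw [h2, sub_im] at h
    rw [show (g (-1 / z)).im = (g z).im + (arg z / 2 - Real.pi / 4) by linarith]
    field_simp
    ring

/-! ### Lattice geometry: the recursion and the length of the dual loop -/

namespace ReflexiveLoop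

theorem cyc_add_length (xs : List Lat) (i : ℕ) : cyc xs (i + xs.length) = cyc xs i := by
  simp [cyc]

/-- A Bézout relation for `p` exhibits `q` as an integer multiple of `p`; one for `q` makes the
factor a unit. -/
theorem eq_or_eq_neg_of_primitive {p q : Lat} (hp : Primitive p) (hq : Primitive q)
    (h : det p q = 0) : q = p ∨ q = -p := by
  obtain ⟨a, b⟩ := p
  obtain ⟨c, d⟩ := q
  simp only [Primitive, det, ← Int.isCoprime_iff_gcd_eq_one] at *
  obtain ⟨g, k, hgk⟩ := hp
  obtain ⟨e, f, hef⟩ := hq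
  have h1 : c = (g * c + k * d) * a := by linear_combination (-c) * hgk - k * h
  have h2 : d = (g * c + k * d) * b := by linear_combination (-d) * hgk + g * h
  have hu : (g * c + k * d) * (e * a + f * b) = 1 := by
    linear_combination hef - e * h1 - f * h2
  rcases Int.isUnit_iff.1 (IsUnit.of_mul_eq_one _ hu) with hm | hm <;> rw [hm] at h1 h2
  · left; ext <;> simp [h1, h2]
  · right; ext <;> simp [h1, h2]

/-- The two steps are parallel and primitive, hence equal up to sign. Opposite steps would give `z =
x`, so the segment would shrink to a point and force `y = x`. -/
theorem sub_eq_sub_of_mem_segment {x y z : Lat} (hx : Primitive (y - x))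
    (hz : Primitive (z - y)) (h : toRat y ∈ segment ℚ (toRat x) (toRat z)) :
    z - y = y - x := by
  obtain ⟨s, t, -, -, hst, h⟩ := h
  simp only [toRat, Prod.smul_mk, Prod.mk_add_mk, smul_eq_mul, Prod.mk.injEq] at h
  obtain ⟨h1, h2⟩ := h
  have hs : s = 1 - t := by linarith
  subst hs
  have hdet : det (y - x) (z - y) = 0 := by
    have : (det (y - x) (z - y) : ℚ) = 0 := by
      simp only [det, Prod.fst_sub, Prod.snd_sub]
      push_cast
      rw [← h1, ← h2]
      ring
    exact_mod_cast this
  rcases eq_or_eq_neg_of_primitive hx hz hdet with h | h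
  · exact h
  · exfalso
    have hzx : z = x := by
      have := congrArg (· + y) h
      simpa using this
    subst hzx
    have e1 : y.1 = z.1 := by
      have : (y.1 : ℚ) = z.1 := by linear_combination -h1
      exact_mod_cast this
    have e2 : y.2 = z.2 := by
      have : (y.2 : ℚ) = z.2 := by linear_combination -h2
      exact_mod_cast this
    simp [Primitive, e1, e2] at hx

/-- Consecutive points of a reflexive loop satisfy a three-term recursion with an integral
coefficient. -/
theorem exists_recursion {l : ℕ} (hl : 0 < l) {x y z : Lat} {e f : ℤ}
    (hd : det x y = e * l) (hd' : det y z = f * l)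
    (hx : Primitive (y - x)) (hz : Primitive (z - y))
    (h : toRat y ∉ segment ℚ (toRat x) (toRat z) → Primitive y) :
    ∃ c : ℤ, det x z = c * l ∧ f * x.1 + e * z.1 = c * y.1 ∧ f * x.2 + e * z.2 = c * y.2 := by
  have hl0 : (l : ℤ) ≠ 0 := by exact_mod_cast hl.ne'
  by_cases hs : toRat y ∈ segment ℚ (toRat x) (toRat z)
  -- Here `y` is the midpoint of `x` and `z`, so `e = f` and `c = 2 * f`.
  · have h1 := sub_eq_sub_of_mem_segment hx hz hs
    have h2 := congrArg Prod.fst h1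
    have h3 := congrArg Prod.snd h1
    simp only [Prod.fst_sub, Prod.snd_sub] at h2 h3
    simp only [det] at *
    have hfe : f = e := by
      apply mul_right_cancel₀ hl0
      rw [← hd, ← hd']
      linear_combination y.1 * h3 - y.2 * h2
    subst hfe
    refine ⟨2 * f, ?_, by linear_combination f * h2, by linear_combination f * h3⟩
    linear_combination 2 * hd + x.1 * h3 - x.2 * h2
  · have hy := h hs
    simp only [Primitive, det, ← Int.isCoprime_iff_gcd_eq_one] at *
    obtain ⟨g, k, hgk⟩ := hy
    -- Coordinates of the identity `det(y,z) x + det(x,y) z = det(x,z) y`. As `y` is primitive, a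
    -- Bézout relation then shows that `l` divides `det(x,z)`.
    have h1 : (f * x.1 + e * z.1) * l = (x.1 * z.2 - x.2 * z.1) * y.1 := by
      linear_combination (-x.1) * hd' - z.1 * hd
    have h2 : (f * x.2 + e * z.2) * l = (x.1 * z.2 - x.2 * z.1) * y.2 := by
      linear_combination (-x.2) * hd' - z.2 * hd
    have hD : x.1 * z.2 - x.2 * z.1 =
        (g * (f * x.1 + e * z.1) + k * (f * x.2 + e * z.2)) * l := by
      linear_combination (-(x.1 * z.2 - x.2 * z.1)) * hgk - g * h1 - k * h2
    refine ⟨_, hD, ?_, ?_⟩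
    · apply mul_right_cancel₀ hl0
      linear_combination h1 + y.1 * hD
    · apply mul_right_cancel₀ hl0
      linear_combination h2 + y.2 * hD

/-- Up to sign, the normals are the steps turned by a right angle, which preserves determinants. -/
theorem det_outerNormal {x y z : Lat} :
    det (outerNormal x y) (outerNormal y z) =
      (det x y).sign * (det y z).sign * (det x y + det y z - det x z) := by
  simp only [outerNormal, det]
  ring

/-- The sum of the determinants of the consecutive points of the path through `ys` and then `b`. -/
def pathDet (ys : List Lat) (b : Lat) : ℤ :=
  ∑ i ∈ Finset.range ys.length, det (ys.getD i b) (ys.getD (i + 1) b)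

/-- The endpoint is the default value of `getD`, so the first path must end where the second begins,
which is `b` itself if `zs` is empty. -/
theorem pathDet_append (ys zs : List Lat) (b : Lat) :
    pathDet (ys ++ zs) b = pathDet ys (zs.getD 0 b) + pathDet zs b := by
  simp only [pathDet, List.length_append, Finset.sum_range_add]
  congr 1
  · refine Finset.sum_congr rfl fun i hi => ?_
    have hi := Finset.mem_range.1 hi
    rw [List.getD_append _ _ _ _ hi, List.getD_eq_getElem _ _ hi, List.getD_eq_getElem _ _ hi]
    congr 1
    rcases (Nat.succ_le_iff.2 hi).lt_or_eq with h | h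
    · rw [List.getD_append _ _ _ _ h, List.getD_eq_getElem _ _ h, List.getD_eq_getElem _ _ h]
    · rw [List.getD_append_right _ _ _ _ h.ge, List.getD_eq_default _ _ h.ge]
      congr 1
      omega
  · refine Finset.sum_congr rfl fun i _ => ?_
    rw [List.getD_append_right _ _ _ _ (by omega), List.getD_append_right _ _ _ _ (by omega)]
    congr 2 <;> omega

theorem length_eq_pathDet (l : ℕ) (ys : List Lat) (b : Lat) (h : ys.getD 0 b = b) :
    length l ys = pathDet ys b / (l : ℚ) := by
  rw [length, pathDet, ← Finset.sum_div]
  push_cast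
  congr 1
  refine Finset.sum_congr rfl fun i hi => ?_
  have hi := Finset.mem_range.1 hi
  have key : ∀ j ≤ ys.length, cyc ys j = ys.getD j b := by
    intro j hj
    rcases hj.lt_or_eq with hj | rfl
    · rw [cyc, Nat.mod_eq_of_lt hj, List.getD_eq_getElem _ _ hj, List.getD_eq_getElem _ _ hj]
    · have h0 : 0 < ys.length := by omega
      rw [cyc, Nat.mod_self, List.getD_eq_default _ _ le_rfl, ← h, List.getD_eq_getElem _ _ h0,
        List.getD_eq_getElem _ _ h0]
  rw [key i hi.le, key (i + 1) hi]

theorem getD_segmentPoints (a b : Lat) {j : ℕ}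
    (hj : j ≤ Int.gcd (b.1 - a.1) (b.2 - a.2)) :
    (segmentPoints a b).getD j b =
      (a.1 + j * ((b.1 - a.1) / Int.gcd (b.1 - a.1) (b.2 - a.2)),
        a.2 + j * ((b.2 - a.2) / Int.gcd (b.1 - a.1) (b.2 - a.2))) := by
  rcases hj.lt_or_eq with h | h
  · rw [List.getD_eq_getElem _ _ (by simpa [segmentPoints] using h)]
    simp [segmentPoints, ← List.map_eq_flatMap]
  · rw [List.getD_eq_default _ _ (by simp [segmentPoints, h]), h,
      Int.mul_ediv_cancel' (Int.gcd_dvd_left ..), Int.mul_ediv_cancel' (Int.gcd_dvd_right ..)]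
    simp

theorem getD_zero_segmentPoints (a b : Lat) : (segmentPoints a b).getD 0 b = a := by
  rw [getD_segmentPoints a b (Nat.zero_le _)]
  simp

/-- For points `a + j v`, each consecutive determinant equals `det(a, v)`, so subdividing a segment
preserves the total. If `a = b`, there are no points and both sides vanish. -/
theorem pathDet_segmentPoints (a b : Lat) : pathDet (segmentPoints a b) b = det a b := by
  have hlen : (segmentPoints a b).length = Int.gcd (b.1 - a.1) (b.2 - a.2) := by
    simp [segmentPoints]
  have h1 := Int.mul_ediv_cancel' (Int.gcd_dvd_left (b.1 - a.1) (b.2 - a.2))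
  have h2 := Int.mul_ediv_cancel' (Int.gcd_dvd_right (b.1 - a.1) (b.2 - a.2))
  rw [pathDet, hlen]
  have hs : ∀ i ∈ Finset.range (Int.gcd (b.1 - a.1) (b.2 - a.2)),
      det ((segmentPoints a b).getD i b) ((segmentPoints a b).getD (i + 1) b) =
        a.1 * ((b.2 - a.2) / Int.gcd (b.1 - a.1) (b.2 - a.2)) -
          a.2 * ((b.1 - a.1) / Int.gcd (b.1 - a.1) (b.2 - a.2)) := by
    intro i hi
    have hi := Finset.mem_range.1 hi
    rw [getD_segmentPoints a b hi.le, getD_segmentPoints a b hi]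
    simp only [det]
    push_cast
    ring
  rw [Finset.sum_congr rfl hs, Finset.sum_const, Finset.card_range, nsmul_eq_mul, det]
  linear_combination a.1 * h2 - a.2 * h1

theorem pathDet_flatMap_segmentPoints (u : ℕ → Lat) (n : ℕ) (b : Lat) (hb : b = u n) :
    ((List.range n).flatMap fun i => segmentPoints (u i) (u (i + 1))).getD 0 b = u 0 ∧
    pathDet ((List.range n).flatMap fun i => segmentPoints (u i) (u (i + 1))) b =
      ∑ i ∈ Finset.range n, det (u i) (u (i + 1)) := by
  induction n generalizing b with
  | zero => simp [pathDet, hb]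
  | succ n ih =>
    obtain ⟨ih1, ih2⟩ := ih (u n) rfl
    have hg := getD_zero_segmentPoints (u n) (u (n + 1))
    rw [List.range_succ, List.flatMap_append, List.flatMap_singleton, hb]
    refine ⟨?_, ?_⟩
    · rw [← ih1]
      -- If the normals so far all coincide, no point has been listed yet, and the first one comes
      -- from the new segment.
      cases (List.range n).flatMap fun i => segmentPoints (u i) (u (i + 1)) with
      | nil => rw [List.nil_append, hg]; simp
      | cons y ys => simp
    · rw [pathDet_append, hg, ih2, pathDet_segmentPoints, Finset.sum_range_succ]

theorem length_dual (l : ℕ) (xs : List Lat) :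
    length l (dual xs) = ∑ i ∈ Finset.range xs.length,
      (det (outerNormal (cyc xs i) (cyc xs (i + 1)))
        (outerNormal (cyc xs (i + 1)) (cyc xs (i + 2))) : ℚ) / (l : ℚ) := by
  let u : ℕ → Lat := fun i => outerNormal (cyc xs i) (cyc xs (i + 1))
  have hu : u xs.length = u 0 := by
    have h0 := cyc_add_length xs 0
    have h1 := cyc_add_length xs 1
    simp only [u]
    rw [add_comm xs.length 1, h1]
    rw [zero_add] at h0
    rw [h0]
  obtain ⟨h1, h2⟩ := pathDet_flatMap_segmentPoints u xs.length (u 0) hu.symm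
  have := length_eq_pathDet l _ _ h1
  rw [h2] at this
  rw [← Finset.sum_div]
  exact_mod_cast this

end ReflexiveLoop

/-! ### Winding number and the eta step along the loop -/

namespace ReflexiveLoop

theorem toComplex_ne_zero {x : Lat} (hx : x ≠ 0) : toComplex x ≠ 0 := by
  intro h
  apply hx
  have h1 := congrArg Complex.re h
  have h2 := congrArg Complex.im h
  simp only [toComplex, Complex.zero_re, Complex.zero_im, Int.cast_eq_zero] at h1 h2
  exact Prod.ext h1 h2

theorem im_toComplex_div (x y : Lat) :
    (toComplex y / toComplex x).im = det x y / Complex.normSq (toComplex x) := by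
  simp only [Complex.div_im, toComplex, det]
  push_cast
  ring

theorem prod_range_succ_div {f : ℕ → ℂ} (hf : ∀ i, f i ≠ 0) (n : ℕ) :
    ∏ i ∈ Finset.range n, f (i + 1) / f i = f n / f 0 := by
  induction n with
  | zero => simp [hf 0]
  | succ n ih => rw [Finset.prod_range_succ, ih, mul_comm, div_mul_div_cancel₀ (hf n)]

/-- The product of the quotients telescopes to `1` around the loop, so the sum of their logarithms
lies in `2πiℤ`. -/
theorem exists_windingNumber_eq {xs : List Lat} (h : ∀ i, cyc xs i ≠ 0) :
    ∃ w : ℤ, windingNumber xs = w := by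
  have h0 : ∀ i, toComplex (cyc xs i) ≠ 0 := fun i => toComplex_ne_zero (h i)
  have hprod : Complex.exp (∑ i ∈ Finset.range xs.length,
      Complex.log (toComplex (cyc xs (i + 1)) / toComplex (cyc xs i))) = 1 := by
    rw [Complex.exp_sum, Finset.prod_congr rfl fun i _ =>
      Complex.exp_log (div_ne_zero (h0 (i + 1)) (h0 i)),
      prod_range_succ_div h0]
    have := cyc_add_length xs 0
    rw [zero_add] at this
    rw [this, div_self (h0 0)]
  obtain ⟨w, hw⟩ := Complex.exp_eq_one_iff.1 hprod
  refine ⟨w, ?_⟩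
  have him := congrArg Complex.im hw
  simp only [Complex.im_sum, Complex.log_im] at him
  rw [windingNumber, him]
  have := Real.pi_ne_zero
  have h2 : (w * (2 * (Real.pi : ℂ) * Complex.I)) = ((w * (2 * Real.pi) : ℝ) : ℂ) * Complex.I := by
    push_cast; ring
  rw [h2, Complex.im_ofReal_mul, Complex.I_im]
  field_simp

/-- One step of the recursion: the normalised quotients `τ` of consecutive points lie in the upper
half plane and are related by an inversion and a translation. -/
theorem arg_eta_step {R : ℂ → ℝ} (hT : ∀ (z : ℂ) (a : ℤ), R (z + a) = R z + a)
    (hS : ∀ z : ℂ, 0 < z.im → R (-1 / z) = R z + 6 / Real.pi * Complex.arg z - 3)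
    {x y z : Lat} (hx : x ≠ 0) (hy : y ≠ 0) {e f c : ℤ} (he : e = 1 ∨ e = -1)
    (hf : f = 1 ∨ f = -1) (hd : 0 < e * det x y)
    (h1 : f * x.1 + e * z.1 = c * y.1) (h2 : f * x.2 + e * z.2 = c * y.2) :
    R (f * (toComplex z / toComplex y)) = R (e * (toComplex y / toComplex x)) +
      (e * f * c + 6 / Real.pi * Complex.arg (toComplex y / toComplex x) - 3 * e) := by
  have hx0 := toComplex_ne_zero hx
  have hy0 := toComplex_ne_zero hy
  have hpos : 0 < Complex.normSq (toComplex x) := Complex.normSq_pos.2 hx0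
  have hxz : (f : ℂ) * toComplex x + e * toComplex z = c * toComplex y := by
    apply Complex.ext
    · simp [toComplex]; exact_mod_cast h1
    · simp [toComplex]; exact_mod_cast h2
  have hee : (e : ℂ) * e = 1 := by rcases he with rfl | rfl <;> norm_num
  have hff : (f : ℂ) * f = 1 := by rcases hf with rfl | rfl <;> norm_num
  have he0 : (e : ℂ) ≠ 0 := left_ne_zero_of_mul_eq_one hee
  have him : 0 < ((e : ℂ) * (toComplex y / toComplex x)).im := by
    rw [Complex.mul_im, im_toComplex_div]
    simp only [Complex.intCast_re, Complex.intCast_im, zero_mul, add_zero]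
    rw [← mul_div_assoc]
    exact div_pos (by exact_mod_cast hd) hpos
  -- The three-term recursion divided by `y`, with `e² = f² = 1`.
  have hτ : (f : ℂ) * (toComplex z / toComplex y) =
      -1 / ((e : ℂ) * (toComplex y / toComplex x)) + ((e * f * c : ℤ) : ℂ) := by
    push_cast
    field_simp
    linear_combination (f : ℂ) * hxz - f * c * toComplex y * hee - toComplex x * hff
  -- For `e = -1` the quotient lies in the lower half plane; negating it adds `π` to its argument,
  -- which turns `-3` into `+3`.
  have harg : 6 / Real.pi * Complex.arg ((e : ℂ) * (toComplex y / toComplex x)) - 3 =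
      6 / Real.pi * Complex.arg (toComplex y / toComplex x) - 3 * e := by
    rcases he with rfl | rfl
    · simp
    · simp only [Int.cast_neg, Int.cast_one, neg_mul, one_mul, Complex.neg_im] at him ⊢
      rw [Complex.arg_neg_eq_arg_add_pi_of_im_neg (by linarith)]
      have := Real.pi_ne_zero
      field_simp
      ring
  rw [hτ, hT, hS _ him, add_sub_assoc, harg]
  push_cast
  ring

theorem sum_range_succ_cyc (xs : List Lat) (F : Lat → Lat → ℚ) :
    ∑ i ∈ Finset.range xs.length, F (cyc xs (i + 1)) (cyc xs (i + 2)) =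
      ∑ i ∈ Finset.range xs.length, F (cyc xs i) (cyc xs (i + 1)) := by
  have h := Finset.sum_range_sub (fun i => F (cyc xs i) (cyc xs (i + 1))) xs.length
  have h0 := cyc_add_length xs 0
  have h1 := cyc_add_length xs 1
  rw [zero_add] at h0
  rw [zero_add, add_comm xs.length 1, h0, h1, sub_self, Finset.sum_sub_distrib, sub_eq_zero] at h
  exact h

end ReflexiveLoop

/-! ### Summation around the loop -/

open ReflexiveLoop in
theorem mainTheorem5 (l : ℕ) (xs : List ReflexiveLoop.Lat)
    (hP : ReflexiveLoop.IsReflexiveLoop l xs) :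
    ∃ w : ℤ, ReflexiveLoop.windingNumber xs = (w : ℝ) ∧
      ReflexiveLoop.length l xs + ReflexiveLoop.length l (ReflexiveLoop.dual xs)
        = 12 * (w : ℚ) := by
  obtain ⟨w, hw⟩ := exists_windingNumber_eq hP.ne_zero
  refine ⟨w, hw, ?_⟩
  have hl : (0 : ℤ) < l := by exact_mod_cast hP.index_pos
  have hlQ : (l : ℚ) ≠ 0 := by exact_mod_cast hP.index_pos.ne'
  let e : ℕ → ℤ := fun i => (det (cyc xs i) (cyc xs (i + 1))).sign
  have he : ∀ i, e i = 1 ∨ e i = -1 := fun i => by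
    rcases hP.det_eq i with h | h
    · left; simp only [e]; rw [h, Int.sign_eq_one_of_pos hl]
    · right; simp only [e]; rw [h, Int.sign_neg, Int.sign_eq_one_of_pos hl]
  have hdet : ∀ i, det (cyc xs i) (cyc xs (i + 1)) = e i * l := fun i => by
    rcases hP.det_eq i with h | h
    · simp only [e]; rw [h, Int.sign_eq_one_of_pos hl, one_mul]
    · simp only [e]; rw [h, Int.sign_neg, Int.sign_eq_one_of_pos hl]; ring
  have hee : ∀ i, e i * e i = 1 := fun i => by rcases he i with h | h <;> rw [h] <;> norm_num
  choose c hc h1 h2 using fun i => exists_recursion hP.index_pos (hdet i) (hdet (i + 1))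
    (hP.primitive_step i) (hP.primitive_step (i + 1)) (hP.primitive_vertex i)
  have hlen : length l xs = ∑ i ∈ Finset.range xs.length, (e i : ℚ) :=
    Finset.sum_congr rfl fun i _ => by
      rw [hdet]; push_cast; field_simp
  have hshift : ∑ i ∈ Finset.range xs.length, (e (i + 1) : ℚ) =
      ∑ i ∈ Finset.range xs.length, (e i : ℚ) :=
    sum_range_succ_cyc xs fun x y => ((det x y).sign : ℚ)
  -- Each summand is `eᵢ eᵢ₊₁ (eᵢ + eᵢ₊₁ - cᵢ)`, expanded with `eᵢ² = 1`.
  have hdual : length l (dual xs) = ∑ i ∈ Finset.range xs.length,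
      ((e (i + 1) : ℚ) + e i - (e i * e (i + 1) * c i : ℤ)) := by
    rw [length_dual]
    refine Finset.sum_congr rfl fun i _ => ?_
    rw [div_eq_iff hlQ, det_outerNormal, hc, hdet i]
    have h := hdet (i + 1)
    rw [show i + 1 + 1 = i + 2 from rfl] at h
    rw [h]
    have hs : ∀ j, (e j * (l : ℤ)).sign = e j := fun j => by
      rw [← hdet]
    rw [hs, hs]
    have hi : (e i : ℚ) * e i = 1 := by exact_mod_cast hee i
    have hi' : (e (i + 1) : ℚ) * e (i + 1) = 1 := by exact_mod_cast hee (i + 1)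
    push_cast
    linear_combination (e (i + 1) * l : ℚ) * hi + (e i * l : ℚ) * hi'
  obtain ⟨R, hT, hS⟩ := exists_arg_eta
  let r : ℕ → ℝ := fun i => R (e i * (toComplex (cyc xs (i + 1)) / toComplex (cyc xs i)))
  have hstep : ∀ i, r (i + 1) - r i = ((e i * e (i + 1) * c i : ℤ) : ℝ) + 6 / Real.pi *
      Complex.arg (toComplex (cyc xs (i + 1)) / toComplex (cyc xs i)) - 3 * e i := fun i => by
    have hpos : 0 < e i * det (cyc xs i) (cyc xs (i + 1)) := by
      rw [hdet, ← mul_assoc, hee, one_mul]; exact hl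
    have := arg_eta_step hT hS (hP.ne_zero i) (hP.ne_zero (i + 1)) (he i) (he (i + 1)) hpos
      (h1 i) (h2 i)
    simp only [r]
    rw [this]
    push_cast
    ring
  have hr : r xs.length = r 0 := by
    have h0 := cyc_add_length xs 0
    have h1 := cyc_add_length xs 1
    rw [zero_add] at h0
    simp only [r, e]
    rw [add_comm xs.length 1, h1, h0]
  -- By periodicity the increments of `r` sum to zero, and the arguments among them sum to `2πw`.
  have htel := Finset.sum_range_sub r xs.length
  rw [hr, sub_self, Finset.sum_congr rfl fun i _ => hstep i, Finset.sum_sub_distrib,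
    Finset.sum_add_distrib, ← Finset.mul_sum, ← Finset.mul_sum] at htel
  have hsum : ∑ i ∈ Finset.range xs.length,
      Complex.arg (toComplex (cyc xs (i + 1)) / toComplex (cyc xs i)) = w * (2 * Real.pi) := by
    rw [← hw, windingNumber, div_mul_cancel₀]
    exact mul_ne_zero two_ne_zero Real.pi_ne_zero
  rw [hsum, show 6 / Real.pi * (w * (2 * Real.pi)) = 12 * (w : ℝ) by
    have := Real.pi_ne_zero
    field_simp
    ring] at htel
  have htelQ : ∑ i ∈ Finset.range xs.length, ((e i * e (i + 1) * c i : ℤ) : ℚ) + 12 * (w : ℚ) -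
      3 * ∑ i ∈ Finset.range xs.length, (e i : ℚ) = 0 := by
    exact_mod_cast htel
  -- Both lengths together are `3 ∑ eᵢ - ∑ eᵢ eᵢ₊₁ cᵢ`.
  rw [hlen, hdual, Finset.sum_sub_distrib, Finset.sum_add_distrib, hshift]
  linear_combination -htelQ
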